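/- All graphs are finite, simple and undirected. A *search tree* on a connected graph $G$ is a rooted tree with vertex set $V(G)$ defined recursively: its root is a vertex $r\in V(G)$, and the children of $r$ are the roots of search trees on the connected components of $G-r$ (one child for each component). For a vertex $w$ of a rooted tree $T$, let $T|w$ denote the subtree consisting of $w$ and its descendants; if $w$ is a child of $u$, we say that $T|w$ is a subtree of $u$. If $T$ is a search tree on $G$ and $v$ is a child of $u$ in $T$, the *rotation* of $u$ and $v$ produces the search tree $T'$ on $G$ in which $u$ is a child of $v$; the vertex $v$ is a child of the parent of $u$ in $T$ (or $v$ is the root of $T'$, if $u$ is the root of $T$); every subtree of $u$ in $T$ other than $T|v$ remains a subtree of $u$; and each subtree $S$ of $v$ in $T$ becomes a subtree of $u$ if $u$ is adjacent in $G$ to a vertex of $S$, and remains a subtree of $v$ otherwise. The *rotation graph* $\mathcal{R}(G)$ has the search trees on $G$ as its vertices, two of them being adjacent if and only if they differ by one rotation. For $v\in V(G)$, let $G_v$ be the graph obtained from $G$ by adding a true twin of $v$, that is, a new vertex $v'$ adjacent exactly to $v$ and to all neighbours of $v$ in $G$. A vertex is *universal* if it is adjacent to all other vertices. **Proposition.**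 Let $G$ be a connected graph with at least two vertices and let $v\in V(G)$ be a universal vertex of $G$. Then $\chi(\mathcal{R}(G_v))=\chi(\mathcal{R}(G))$. -/

import Mathlib

/-- A rooted tree with vertex set `V`, given by its root and its parent map. The root has no parent;
by convention `parent root = root`. -/
@[ext]
structure LabelledRootedTree (V : Type*) where
  root : V
  parent : V → V
  parent_root : parent root = root
  exists_iterate_parent_eq_root : ∀ w, ∃ n : ℕ, parent^[n] w = root

namespace LabelledRootedTree

variable {V : Type*}

/-- `w` is a child of `u` in the rooted tree `T`. -/
def IsChild (T : LabelledRootedTree V) (w u : V) : Prop :=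
  w ≠ T.root ∧ T.parent w = u

/-- The vertex set of the subtree `T|w` rooted at `w`: the vertex `w` and all its descendants. -/
def subtree (T : LabelledRootedTree V) (w : V) : Set V :=
  {x | ∃ n : ℕ, T.parent^[n] x = w}

/-- `T.IsSearchTreeOn G S r`: inside the rooted tree `T`, the vertex `r` is the root of a search
tree on the subgraph of `G` induced by `S`. Recursively, `r` is a vertex of `S`, and the children
of `r` are the roots `c C` of search trees on the connected components `C` of `G[S] - r`. -/
inductive IsSearchTreeOn (G : SimpleGraph V) (T : LabelledRootedTree V) : Set V → V → Prop
  | node (S : Set V) (r : V) (hr : r ∈ S)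
      (c : (G.induce (S \ {r})).ConnectedComponent → V)
      (children : {w | T.IsChild w r} = Set.range c)
      (isSearchTreeOn : ∀ C : (G.induce (S \ {r})).ConnectedComponent,
        IsSearchTreeOn G T (Subtype.val '' C.supp) (c C)) :
      IsSearchTreeOn G T S r

/-- `T` is a search tree on the graph `G`. -/
def IsSearchTree (G : SimpleGraph V) (T : LabelledRootedTree V) : Prop :=
  T.IsSearchTreeOn G Set.univ T.root

/-- `T'` is obtained from `T` by the rotation of `u` and `v`, where `v` is a child of `u` in `T`. -/
structure IsRotation (G : SimpleGraph V) (T T' : LabelledRootedTree V) (u v : V) : Prop where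
  /-- `v` is a child of `u` in `T` -/
  isChild : T.IsChild v u
  /-- `u` is a child of `v` in `T'` -/
  isChild' : T'.IsChild u v
  /-- if `u` is the root of `T`, then `v` is the root of `T'` -/
  root_eq_of_eq : T.root = u → T'.root = v
  /-- otherwise the root does not change -/
  root_eq_of_ne : T.root ≠ u → T'.root = T.root
  /-- and `v` becomes a child of the parent of `u` in `T` -/
  parent_eq : T.root ≠ u → T'.parent v = T.parent u
  /-- a subtree of `v` in `T` with a vertex adjacent to `u` in `G` becomes a subtree of `u` -/
  parent_of_adj : ∀ w, T.IsChild w v → (∃ x ∈ T.subtree w, G.Adj u x) → T'.parent w = u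
  /-- the other subtrees of `v` remain subtrees of `v` -/
  parent_of_not_adj : ∀ w, T.IsChild w v → (¬ ∃ x ∈ T.subtree w, G.Adj u x) → T'.parent w = v
  /-- all other parents are unchanged; in particular the subtrees of `u` other than `T|v` remain
  subtrees of `u` -/
  parent_of_ne : ∀ w, w ≠ u → w ≠ v → ¬ T.IsChild w v → T'.parent w = T.parent w

end LabelledRootedTree

namespace SimpleGraph

/-- The rotation graph of `G`: its vertices are the search trees on `G`, and two search trees are
adjacent if and only if they differ by one rotation. -/
def rotationGraph {V : Type*} (G : SimpleGraph V) :
    SimpleGraph {T : LabelledRootedTree V // T.IsSearchTree G} :=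
  SimpleGraph.fromRel fun T T' => ∃ u v : V, LabelledRootedTree.IsRotation G T.1 T'.1 u v

/-- The graph obtained from `G` by adding a true twin of `v`. The new vertex is `none`; it is
adjacent to `v` and to all neighbours of `v`. -/
def addTrueTwin {V : Type*} (G : SimpleGraph V) (v : V) : SimpleGraph (Option V) where
  Adj
    | some a, some b => G.Adj a b
    | some a, none => a = v ∨ G.Adj v a
    | none, some b => b = v ∨ G.Adj v b
    | none, none => False
  symm := ⟨fun a b => by cases a <;> cases b <;> simp [G.adj_comm]⟩
  loopless := ⟨fun a => by cases a <;> simp⟩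

end SimpleGraph

/-! Write `none` for the twin `v'`. Putting `none` above the root of a search tree on `G` turns
rotations into rotations, so it is a homomorphism of rotation graphs
(`rotationGraphHomAddTrueTwin`); this gives one inequality.

For the other, call a search tree on `G.addTrueTwin v` upper if `none` lies above `some v`. A vertex
strictly above a universal vertex has only one child, so deleting `none` from an upper tree `T`
leaves a search tree `D T` on `G` (`IsEliminationTree.exists_delete_none`). Given a proper colouring
`c` by residues modulo `n ≥ 2`, colour `T` by `c (D T)` plus the parity of the size of the subtree
of `none`. A rotation between upper trees that involves `none` fixes `D T` and changes that size by
one (`IsRotation.of_none`); any other one rotates `D T` and keeps the size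
(`IsRotation.delete_none`). A tree that is not upper becomes upper when the twins are interchanged,
and is coloured through that upper tree with the opposite parity. A rotation between the two kinds
must be that of the twins themselves; then both trees have the same upper tree and opposite parities
(`IsRotation.eq_map_swap`). That two colours are available follows from `exists_isRotation`.

Throughout, a tree is handled through its family of subtrees: `IsEliminationTree` describes search
trees this way, and `IsRotation.of_subtree_eq` rotations. -/

namespace LabelledRootedTree

/-! ### Rooted trees and their descendant order. -/

variable {V : Type*} (T : LabelledRootedTree V)

theorem mem_subtree_self (x : V) : x ∈ T.subtree x := ⟨0, rfl⟩

variable {T}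

theorem mem_subtree_trans {x y z : V} (h : x ∈ T.subtree y) (h' : y ∈ T.subtree z) :
    x ∈ T.subtree z := by
  obtain ⟨n, rfl⟩ := h
  obtain ⟨m, rfl⟩ := h'
  exact ⟨m + n, by rw [Function.iterate_add_apply]⟩

variable (T) in
theorem mem_subtree_parent (x : V) : x ∈ T.subtree (T.parent x) := ⟨1, rfl⟩

variable (T) in
theorem subtree_root : T.subtree T.root = Set.univ :=
  Set.eq_univ_of_forall T.exists_iterate_parent_eq_root

theorem parent_mem_subtree {x z : V} (h : x ∈ T.subtree z) (hne : x ≠ z) :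
    T.parent x ∈ T.subtree z := by
  obtain ⟨n, hn⟩ := h
  cases n with
  | zero => exact absurd hn hne
  | succ n => exact ⟨n, by rwa [Function.iterate_succ_apply] at hn⟩

theorem mem_subtree_or_of_mem {x y z : V} (hy : x ∈ T.subtree y) (hz : x ∈ T.subtree z) :
    y ∈ T.subtree z ∨ z ∈ T.subtree y := by
  obtain ⟨n, rfl⟩ := hy
  obtain ⟨m, rfl⟩ := hz
  rcases le_total n m with h | h
  · exact Or.inl ⟨m - n, by rw [← Function.iterate_add_apply, Nat.sub_add_cancel h]⟩
  · exact Or.inr ⟨n - m, by rw [← Function.iterate_add_apply, Nat.sub_add_cancel h]⟩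

variable (T) in
theorem iterate_parent_root (n : ℕ) : T.parent^[n] T.root = T.root :=
  Function.iterate_fixed T.parent_root n

/-- The parent map has no cycle besides the fixed root: going round the cycle often enough passes
the root, which is never left again. Antisymmetry of the descendant order rests on this. -/
theorem eq_root_of_iterate_parent_eq {x : V} {k : ℕ} (hk : k ≠ 0) (h : T.parent^[k] x = x) :
    x = T.root := by
  obtain ⟨N, hN⟩ := T.exists_iterate_parent_eq_root x
  have h1 : T.parent^[k * N] x = x := by
    rw [Function.iterate_mul]
    exact Function.iterate_fixed h N
  have h2 : k * N = (k * N - N) + N :=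
    (Nat.sub_add_cancel (Nat.le_mul_of_pos_left N (Nat.pos_of_ne_zero hk))).symm
  rw [h2, Function.iterate_add_apply, hN, iterate_parent_root] at h1
  exact h1.symm

theorem mem_subtree_antisymm {x y : V} (h : x ∈ T.subtree y) (h' : y ∈ T.subtree x) : x = y := by
  obtain ⟨n, hn⟩ := h
  obtain ⟨m, hm⟩ := h'
  rcases Nat.eq_zero_or_pos n with rfl | hpos
  · exact hn
  · have hx : x = T.root := by
      refine eq_root_of_iterate_parent_eq (k := m + n) (by omega) ?_
      rw [Function.iterate_add_apply, hn, hm]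
    rw [← hn, hx, iterate_parent_root]

theorem parent_ne_self {x : V} (hx : x ≠ T.root) : T.parent x ≠ x := fun h =>
  hx (eq_root_of_iterate_parent_eq one_ne_zero h)

theorem parent_notMem_subtree {x : V} (hx : x ≠ T.root) : T.parent x ∉ T.subtree x := fun h =>
  parent_ne_self hx (mem_subtree_antisymm h (T.mem_subtree_parent x))

theorem eq_root_of_root_mem_subtree {z : V} (h : T.root ∈ T.subtree z) : z = T.root :=
  mem_subtree_antisymm (by simp [subtree_root]) h

theorem ne_root_of_mem_subtree {x z : V} (h : x ∈ T.subtree z) (hne : x ≠ z) : x ≠ T.root := by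
  rintro rfl
  exact hne (eq_root_of_root_mem_subtree h).symm

/-- The parent of `w` is the unique proper ancestor of `w` below which no other one lies. -/
theorem parent_eq_of_forall {w p : V} (hp : w ∈ T.subtree p) (hne : w ≠ p)
    (h : ∀ q, w ∈ T.subtree q → w ≠ q → q ∈ T.subtree p → q = p) : T.parent w = p :=
  h _ (T.mem_subtree_parent w) (parent_ne_self (ne_root_of_mem_subtree hp hne)).symm
    (parent_mem_subtree hp hne)

theorem IsChild.mem_subtree {w u : V} (h : T.IsChild w u) : w ∈ T.subtree u := ⟨1, h.2⟩

theorem IsChild.ne {w u : V} (h : T.IsChild w u) : w ≠ u := fun h' =>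
  parent_ne_self h.1 (h.2.trans h'.symm)

theorem IsChild.notMem_subtree {w u : V} (h : T.IsChild w u) : u ∉ T.subtree w :=
  h.2 ▸ parent_notMem_subtree h.1

theorem IsChild.mem_subtree_of_mem {w u z : V} (h : T.IsChild w u) (hz : w ∈ T.subtree z)
    (hne : w ≠ z) : u ∈ T.subtree z :=
  h.2 ▸ parent_mem_subtree hz hne

theorem isChild_of_forall {w p : V} (hp : w ∈ T.subtree p) (hne : w ≠ p)
    (h : ∀ q, w ∈ T.subtree q → w ≠ q → q ∈ T.subtree p → q = p) : T.IsChild w p :=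
  ⟨ne_root_of_mem_subtree hp hne, parent_eq_of_forall hp hne h⟩

/-- A proper descendant of `r` lies in the subtree of a child of `r`. -/
theorem exists_isChild_mem_subtree {x r : V} (h : x ∈ T.subtree r) (hne : x ≠ r) :
    ∃ w, T.IsChild w r ∧ x ∈ T.subtree w := by
  obtain ⟨n, hn⟩ := h
  induction n generalizing x with
  | zero => exact absurd hn hne
  | succ n ih =>
    have hx : x ≠ T.root := ne_root_of_mem_subtree ⟨n + 1, hn⟩ hne
    rw [Function.iterate_succ_apply] at hn
    by_cases hp : T.parent x = r
    · exact ⟨x, ⟨hx, hp⟩, T.mem_subtree_self x⟩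
    · obtain ⟨w, hw, hxw⟩ := ih hp hn
      exact ⟨w, hw, mem_subtree_trans (T.mem_subtree_parent x) hxw⟩

theorem IsChild.eq_of_mem_subtree {w w' r : V} (h : T.IsChild w r) (h' : T.IsChild w' r)
    (hm : w ∈ T.subtree w') : w = w' := by
  by_contra hne
  exact h'.notMem_subtree (h.mem_subtree_of_mem hm hne)

theorem eq_of_subtree_eq {T T' : LabelledRootedTree V} (h : ∀ z, T.subtree z = T'.subtree z) :
    T = T' := by
  have hr : T.root = T'.root := by
    apply eq_root_of_root_mem_subtree
    rw [← h, subtree_root]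
    trivial
  ext w
  · exact hr
  · by_cases hw : w = T.root
    · rw [hw, T.parent_root, hr, T'.parent_root]
    · have hw' : w ≠ T'.root := hr ▸ hw
      apply mem_subtree_antisymm (T := T)
      · exact parent_mem_subtree (by rw [h]; exact T'.mem_subtree_parent w)
          (parent_ne_self hw').symm
      · rw [h]
        exact parent_mem_subtree (by rw [← h]; exact T.mem_subtree_parent w)
          (parent_ne_self hw).symm

/-- A family of sets that behaves like the family of principal down-sets of a finite rooted tree
order is the family of subtrees of a rooted tree. -/
theorem exists_subtree_eq [Finite V] (s : V → Set V) (r : V) (hr : ∀ x, x ∈ s r)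
    (hrefl : ∀ x, x ∈ s x) (htrans : ∀ x y z, x ∈ s y → y ∈ s z → x ∈ s z)
    (hanti : ∀ x y, x ∈ s y → y ∈ s x → x = y)
    (hchain : ∀ x y z, x ∈ s y → x ∈ s z → y ∈ s z ∨ z ∈ s y) :
    ∃ T : LabelledRootedTree V, ∀ z, T.subtree z = s z := by
  classical
  have hlt : ∀ x y, x ∈ s y → x ≠ y → (s x).ncard < (s y).ncard := fun x y h hne =>
    Set.ncard_lt_ncard ⟨fun z hz => htrans z x y hz h, fun h' => hne (hanti x y h (h' (hrefl y)))⟩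
      (Set.toFinite _)
  -- The parent of `w` is a smallest set of the family among those of vertices other than `w` that
  -- contain `w`; by `hchain` it is the least one.
  have hex : ∀ w, ∃ p, (w = r → p = r) ∧ (w ≠ r → w ∈ s p ∧ w ≠ p ∧
      ∀ q, w ∈ s q → w ≠ q → p ∈ s q) := by
    intro w
    by_cases hw : w = r
    · exact ⟨r, fun _ => rfl, fun h => absurd hw h⟩
    · obtain ⟨p, hp, hmin⟩ := Set.exists_min_image {p | w ∈ s p ∧ w ≠ p} (fun p => (s p).ncard)
        (Set.toFinite _) ⟨r, hr w, hw⟩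
      refine ⟨p, fun h => absurd h hw, fun _ => ⟨hp.1, hp.2, fun q hq hne => ?_⟩⟩
      rcases hchain w p q hp.1 hq with h | h
      · exact h
      · by_cases hpq : q = p
        · exact hpq ▸ hrefl q
        · exact absurd (hlt q p h hpq) (not_lt.2 (hmin q ⟨hq, hne⟩))
  choose par hpar_r hpar using hex
  have hmem : ∀ (k : ℕ) (x z : V), (s z).ncard - (s x).ncard = k → x ∈ s z →
      ∃ n : ℕ, par^[n] x = z := by
    intro k
    induction k using Nat.strong_induction_on with
    | _ k ih =>
      intro x z hk hx
      by_cases hxz : x = z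
      · exact ⟨0, hxz⟩
      · have hxr : x ≠ r := by
          rintro rfl
          exact hxz (hanti _ _ hx (hr z))
        obtain ⟨h1, h2, h3⟩ := hpar x hxr
        have h4 := hlt _ _ h1 h2
        have h5 := hlt _ _ hx hxz
        obtain ⟨n, hn⟩ := ih _ (by omega) (par x) z rfl (h3 z hx hxz)
        exact ⟨n + 1, by rwa [Function.iterate_succ_apply]⟩
  let T : LabelledRootedTree V :=
    { root := r
      parent := par
      parent_root := hpar_r r rfl
      exists_iterate_parent_eq_root := fun w => hmem _ w r rfl (hr w) }
  refine ⟨T, fun z => Set.Subset.antisymm ?_ fun x hx => hmem _ x z rfl hx⟩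
  rintro x ⟨n, hn⟩
  induction n generalizing x with
  | zero => exact hn ▸ hrefl x
  | succ n ih =>
    refine htrans x (par x) z ?_ (ih (by rwa [Function.iterate_succ_apply] at hn))
    by_cases hx : x = r
    · rw [hpar_r x hx, hx]
      exact hrefl r
    · exact (hpar x hx).1

/-- Relabelling the vertices of a rooted tree. -/
def map {W : Type*} (T : LabelledRootedTree V) (e : V ≃ W) : LabelledRootedTree W where
  root := e T.root
  parent w := e (T.parent (e.symm w))
  parent_root := by simp [T.parent_root]
  exists_iterate_parent_eq_root w := by
    obtain ⟨n, hn⟩ := T.exists_iterate_parent_eq_root (e.symm w)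
    refine ⟨n, ?_⟩
    rw [← hn]
    have := Function.Semiconj.iterate_right (f := e) (ga := T.parent)
      (gb := fun w => e (T.parent (e.symm w))) (fun x => by simp) n
    simpa using (this (e.symm w)).symm

theorem mem_subtree_map {W : Type*} {e : V ≃ W} {x z : W} :
    x ∈ (T.map e).subtree z ↔ e.symm x ∈ T.subtree (e.symm z) := by
  have := fun n => Function.Semiconj.iterate_right (f := e) (ga := T.parent)
      (gb := fun w => e (T.parent (e.symm w))) (fun x => by simp) n (e.symm x)
  simp only [Equiv.apply_symm_apply] at this
  constructor
  · rintro ⟨n, hn⟩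
    exact ⟨n, by rw [← hn]; simp [map, ← this]⟩
  · rintro ⟨n, hn⟩
    exact ⟨n, by simp [map, ← this, hn]⟩

theorem isChild_map {W : Type*} {e : V ≃ W} {x z : V} :
    (T.map e).IsChild (e x) (e z) ↔ T.IsChild x z := by
  simp [IsChild, map]

end LabelledRootedTree

/-! ### Connectedness as the absence of closed proper subsets. -/

namespace SimpleGraph

variable {V : Type*} (G : SimpleGraph V)

/-- No edge of `G[S]` leaves a proper nonempty subset of `S`, i.e. `G[S]` is preconnected. -/
def IsLinked (S : Set V) : Prop :=
  ∀ A ⊆ S, A.Nonempty → (∀ x ∈ A, ∀ y ∈ S, G.Adj x y → y ∈ A) → S ⊆ A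

variable {G}

theorem mem_image_supp_of_adj {S : Set V} (C : (G.induce S).ConnectedComponent) {x y : V}
    (hx : x ∈ Subtype.val '' C.supp) (hy : y ∈ S) (h : G.Adj x y) :
    y ∈ Subtype.val '' C.supp := by
  obtain ⟨x, hxC, rfl⟩ := hx
  exact ⟨⟨y, hy⟩, C.mem_supp_of_adj_mem_supp hxC h, rfl⟩

theorem isLinked_image_supp {S : Set V} (C : (G.induce S).ConnectedComponent) :
    G.IsLinked (Subtype.val '' C.supp) := by
  rintro A hA ⟨a, ha⟩ hcl _ ⟨y, hy, rfl⟩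
  obtain ⟨x, hx, rfl⟩ := hA ha
  have hr := C.reachable_of_mem_supp hx hy
  rw [reachable_iff_reflTransGen] at hr
  clear hy
  induction hr with
  | refl => exact ha
  | @tail b d _ hbd ih =>
    exact hcl _ ih _ (mem_image_supp_of_adj C (hA ih) d.2 hbd) hbd

theorem Connected.isLinked_univ (h : G.Connected) : G.IsLinked Set.univ := by
  rintro A - ⟨a, ha⟩ hcl y -
  have hr := h.preconnected a y
  rw [reachable_iff_reflTransGen] at hr
  induction hr with
  | refl => exact ha
  | tail _ hbd ih => exact hcl _ ih _ trivial hbd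

end SimpleGraph

/-! ### Search trees described without recursion. -/

namespace LabelledRootedTree

variable {V : Type*} {G : SimpleGraph V} {T T' : LabelledRootedTree V}

/-- The nonrecursive description of search trees: adjacent vertices are comparable, and the parent
of a vertex `w` has a neighbour in the subtree of `w`. -/
structure IsEliminationTree (G : SimpleGraph V) (T : LabelledRootedTree V) : Prop where
  mem_or_mem : ∀ x y, G.Adj x y → x ∈ T.subtree y ∨ y ∈ T.subtree x
  exists_adj : ∀ w, w ≠ T.root → ∃ x ∈ T.subtree w, G.Adj (T.parent w) x

/-- Induction over the recursive definition: the components of `G[S] - r` are the subtrees of the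
children of `r`, so no edge joins incomparable vertices. Linkedness of `S` yields the neighbour of a
parent. -/
theorem IsSearchTreeOn.spec {S : Set V} {r : V} (h : T.IsSearchTreeOn G S r)
    (hS : G.IsLinked S) : S = T.subtree r ∧
      (∀ x ∈ S, ∀ y ∈ S, G.Adj x y → x ∈ T.subtree y ∨ y ∈ T.subtree x) ∧
      ∀ w ∈ S, w ≠ r → ∃ x ∈ T.subtree w, G.Adj (T.parent w) x := by
  induction h with
  | node S r hr c children _ ih =>
    replace ih := fun C => ih C (SimpleGraph.isLinked_image_supp C)
    have hchild : ∀ C, T.IsChild (c C) r := fun C => by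
      have : c C ∈ {w | T.IsChild w r} := children ▸ Set.mem_range_self C
      exact this
    have hsub : ∀ C : (G.induce (S \ {r})).ConnectedComponent, Subtype.val '' C.supp ⊆ S := by
      rintro C _ ⟨x, -, rfl⟩
      exact x.2.1
    have hcomp : ∀ x ∈ S, x ≠ r → ∃ C : (G.induce (S \ {r})).ConnectedComponent,
        x ∈ Subtype.val '' C.supp := fun x hx hne =>
      ⟨(G.induce (S \ {r})).connectedComponentMk ⟨x, hx, hne⟩, ⟨x, hx, hne⟩, rfl, rfl⟩
    have hSr : S = T.subtree r := by
      apply Set.Subset.antisymm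
      · intro x hx
        by_cases hxr : x = r
        · exact hxr ▸ T.mem_subtree_self x
        · obtain ⟨C, hC⟩ := hcomp x hx hxr
          rw [(ih C).1] at hC
          exact mem_subtree_trans hC (hchild C).mem_subtree
      · intro x hx
        by_cases hxr : x = r
        · exact hxr ▸ hr
        · obtain ⟨w, hw, hxw⟩ := exists_isChild_mem_subtree hx hxr
          have : w ∈ {w | T.IsChild w r} := hw
          rw [children] at this
          obtain ⟨C, rfl⟩ := this
          rw [← (ih C).1] at hxw
          exact hsub C hxw
    refine ⟨hSr, fun x hx y hy hxy => ?_, fun w hw hne => ?_⟩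
    · by_cases hxr : x = r
      · exact Or.inr (by rwa [hxr, ← hSr])
      by_cases hyr : y = r
      · exact Or.inl (by rwa [hyr, ← hSr])
      obtain ⟨C, hC⟩ := hcomp x hx hxr
      exact (ih C).2.1 x hC y (SimpleGraph.mem_image_supp_of_adj C hC ⟨hy, hyr⟩ hxy) hxy
    · obtain ⟨C, hC⟩ := hcomp w hw hne
      by_cases hwc : w = c C
      · subst hwc
        rw [(hchild C).2]
        -- If `r` had no neighbour in the component `C`, then `C` would be closed in `G[S]`, and
        -- linkedness would force `r` into it.
        by_contra hcon
        push Not at hcon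
        have hrC : r ∈ Subtype.val '' C.supp :=
          hS (Subtype.val '' C.supp) (hsub C) ⟨_, hC⟩ (fun x hx y hy hxy => by
            refine SimpleGraph.mem_image_supp_of_adj C hx ⟨hy, ?_⟩ hxy
            rintro rfl
            rw [(ih C).1] at hx
            exact hcon x hx hxy.symm) hr
        obtain ⟨x, -, hx⟩ := hrC
        exact x.2.2 hx
      · exact (ih C).2.2 w hC hwc

theorem IsSearchTree.isEliminationTree (h : T.IsSearchTree G) (hG : G.Connected) :
    T.IsEliminationTree G := by
  obtain ⟨-, h1, h2⟩ := IsSearchTreeOn.spec h hG.isLinked_univ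
  exact ⟨fun x y => h1 x trivial y trivial, fun w => h2 w trivial⟩

theorem ncard_subtree_lt [Finite V] {w r : V} (h : T.IsChild w r) :
    (T.subtree w).ncard < (T.subtree r).ncard :=
  Set.ncard_lt_ncard ⟨fun _ hx => mem_subtree_trans hx h.mem_subtree,
    fun h' => h.notMem_subtree (h' (T.mem_subtree_self r))⟩ (Set.toFinite _)

/-- By induction, a closed set meeting the subtree of a child of `r` contains it. The edge from that
subtree to `r` then brings in `r`, and the edges from `r` bring in the subtrees of all other
children. -/
theorem IsEliminationTree.isLinked_subtree [Finite V] (h : T.IsEliminationTree G) (r : V) :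
    G.IsLinked (T.subtree r) := by
  induction hk : (T.subtree r).ncard using Nat.strong_induction_on generalizing r with
  | _ k ih =>
    rintro A hA ⟨a, ha⟩ hcl
    have hsub : ∀ w, T.IsChild w r → (∃ x ∈ A, x ∈ T.subtree w) → T.subtree w ⊆ A := by
      rintro w hw ⟨x, hxA, hxw⟩
      refine (ih _ (hk ▸ ncard_subtree_lt hw) w rfl (A ∩ T.subtree w) Set.inter_subset_right
        ⟨x, hxA, hxw⟩ fun y hy z hz hyz => ⟨hcl y hy.1 z ?_ hyz, hz⟩).trans Set.inter_subset_left
      exact mem_subtree_trans hz hw.mem_subtree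
    have hr : r ∈ A := by
      by_cases har : a = r
      · exact har ▸ ha
      · obtain ⟨w, hw, haw⟩ := exists_isChild_mem_subtree (hA ha) har
        obtain ⟨x, hx, hadj⟩ := h.exists_adj w hw.1
        rw [hw.2] at hadj
        exact hcl x (hsub w hw ⟨a, ha, haw⟩ hx) r (T.mem_subtree_self r) hadj.symm
    intro y hy
    by_cases hyr : y = r
    · exact hyr ▸ hr
    · obtain ⟨w, hw, hyw⟩ := exists_isChild_mem_subtree hy hyr
      obtain ⟨x, hx, hadj⟩ := h.exists_adj w hw.1
      rw [hw.2] at hadj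
      exact hsub w hw ⟨x, hcl r hr x (mem_subtree_trans hx hw.mem_subtree) hadj, hx⟩ hyw

/-- Subtrees of distinct children of `r` are not joined by edges, and each of them is linked, so
they are exactly the components left after removing `r`. -/
theorem IsEliminationTree.isSearchTreeOn [Finite V] (h : T.IsEliminationTree G) (r : V) :
    T.IsSearchTreeOn G (T.subtree r) r := by
  induction hk : (T.subtree r).ncard using Nat.strong_induction_on generalizing r with
  | _ k ih =>
    have hex : ∀ C : (G.induce (T.subtree r \ {r})).ConnectedComponent, ∃ w, T.IsChild w r ∧
        Subtype.val '' C.supp = T.subtree w := by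
      intro C
      obtain ⟨x, hx⟩ := C.nonempty_supp
      have hxC : x.1 ∈ Subtype.val '' C.supp := ⟨x, hx, rfl⟩
      obtain ⟨w, hw, hxw⟩ := exists_isChild_mem_subtree x.2.1 x.2.2
      refine ⟨w, hw, Set.Subset.antisymm ?_ ?_⟩
      · refine (SimpleGraph.isLinked_image_supp C (Subtype.val '' C.supp ∩ T.subtree w)
          Set.inter_subset_left ⟨x, hxC, hxw⟩ fun y hy z hz hyz => ⟨hz, ?_⟩).trans
          Set.inter_subset_right
        rcases h.mem_or_mem y z hyz with hm | hm
        · rcases mem_subtree_or_of_mem hm hy.2 with hm' | hm'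
          · exact hm'
          · by_cases hwz : w = z
            · exact hwz ▸ T.mem_subtree_self w
            · obtain ⟨z, -, rfl⟩ := hz
              exact absurd (mem_subtree_antisymm z.2.1 (hw.mem_subtree_of_mem hm' hwz)) z.2.2
        · exact mem_subtree_trans hm hy.2
      · refine (h.isLinked_subtree w (Subtype.val '' C.supp ∩ T.subtree w)
          Set.inter_subset_right ⟨x, hxC, hxw⟩ fun y hy z hz hyz => ⟨?_, hz⟩).trans
          Set.inter_subset_left
        refine SimpleGraph.mem_image_supp_of_adj C hy.1
          ⟨mem_subtree_trans hz hw.mem_subtree, ?_⟩ hyz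
        rintro rfl
        exact hw.notMem_subtree hz
    choose c hc hcs using hex
    refine .node _ r (T.mem_subtree_self r) c (Set.Subset.antisymm ?_ ?_) fun C => ?_
    · intro w hw
      have hw' : T.IsChild w r := hw
      have hmem : w ∈ T.subtree r \ {r} := ⟨hw'.mem_subtree, hw'.ne⟩
      refine ⟨(G.induce _).connectedComponentMk ⟨w, hmem⟩, ?_⟩
      refine ((hw'.eq_of_mem_subtree (hc _)) ?_).symm
      rw [← hcs]
      exact ⟨⟨w, hmem⟩, rfl, rfl⟩
    · rintro _ ⟨C, rfl⟩
      exact hc C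
    · rw [hcs]
      exact ih _ (hk ▸ ncard_subtree_lt (hc C)) _ rfl

theorem IsEliminationTree.isSearchTree [Finite V] (h : T.IsEliminationTree G) :
    T.IsSearchTree G := by
  have := h.isSearchTreeOn T.root
  rwa [subtree_root] at this

theorem IsEliminationTree.map {W : Type*} {H : SimpleGraph W} (h : T.IsEliminationTree G)
    (e : V ≃ W) (he : ∀ x y, H.Adj (e x) (e y) ↔ G.Adj x y) : (T.map e).IsEliminationTree H where
  mem_or_mem x y hxy := by
    rw [mem_subtree_map, mem_subtree_map]
    apply h.mem_or_mem
    rw [← he]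
    simpa using hxy
  exists_adj w hw := by
    have hw' : e.symm w ≠ T.root := fun h' => hw (by simp [LabelledRootedTree.map, ← h'])
    obtain ⟨x, hx, hadj⟩ := h.exists_adj _ hw'
    exact ⟨e x, by simpa [mem_subtree_map] using hx, (he _ _).2 hadj⟩

/-! ### Rotations expressed through subtrees. -/

namespace IsRotation

variable {u v : V}

theorem ne (h : IsRotation G T T' u v) : v ≠ u := h.isChild.ne

theorem parent_of_isChild (h : IsRotation G T T' u v) {w : V} (hw : T.IsChild w v) :
    T'.parent w = u ∨ T'.parent w = v := by
  by_cases hadj : ∃ x ∈ T.subtree w, G.Adj u x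
  · exact Or.inl (h.parent_of_adj w hw hadj)
  · exact Or.inr (h.parent_of_not_adj w hw hadj)

/-- Climb from `x` to `z` in `T` and follow each step in `T'`. The subtrees of `u` and `v` have to
be treated together, since all that can be said of a vertex in either is that it ends up below `v`.
-/
theorem mem_of_mem (h : IsRotation G T T' u v) {x z : V} (hx : x ∈ T.subtree z) :
    (z ≠ u → z ≠ v → x ∈ T'.subtree z) ∧ (z = u ∨ z = v → x ∈ T'.subtree v) := by
  have huv : u ∈ T'.subtree v := h.isChild'.mem_subtree
  obtain ⟨n, hn⟩ := hx
  induction n generalizing z with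
  | zero =>
    obtain rfl : x = z := hn
    refine ⟨fun _ _ => T'.mem_subtree_self x, ?_⟩
    rintro (rfl | rfl)
    · exact huv
    · exact T'.mem_subtree_self _
  | succ n ih =>
    rw [Function.iterate_succ_apply'] at hn
    generalize T.parent^[n] x = y at hn ih
    obtain ⟨ih1, ih2⟩ := ih rfl
    -- The parent map is constant at the root, so such a step does not move.
    by_cases hyr : y = T.root
    · rw [hyr, T.parent_root, ← hyr] at hn
      exact hn ▸ ⟨ih1, ih2⟩
    have hy : T.IsChild y z := ⟨hyr, hn⟩
    refine ⟨fun hzu hzv => ?_, ?_⟩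
    · by_cases hyu : y = u
      · subst hyu
        have := h.parent_eq (fun h' => hyr h'.symm)
        rw [hn] at this
        exact mem_subtree_trans (ih2 (Or.inl rfl)) ⟨1, this⟩
      · have hyv : y ≠ v := by
          rintro rfl
          exact hzu (hn.symm.trans h.isChild.2)
        have := h.parent_of_ne y hyu hyv (fun h' => hzv (hn.symm.trans h'.2))
        rw [hn] at this
        exact mem_subtree_trans (ih1 hyu hyv) ⟨1, this⟩
    · rintro (rfl | rfl)
      · by_cases hyv : y = v
        · exact ih2 (Or.inr hyv)
        · have := h.parent_of_ne y hy.ne hyv (fun h' => h.ne (h'.2.symm.trans hn))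
          rw [hn] at this
          exact mem_subtree_trans (mem_subtree_trans (ih1 hy.ne hyv) ⟨1, this⟩) huv
      · have hyu : y ≠ u := by
          rintro rfl
          exact hy.notMem_subtree h.isChild.mem_subtree
        have hyT := ih1 hyu hy.ne
        rcases h.parent_of_isChild hy with h' | h'
        · exact mem_subtree_trans (mem_subtree_trans hyT ⟨1, h'⟩) huv
        · exact mem_subtree_trans hyT ⟨1, h'⟩

theorem mem_of_mem' (h : IsRotation G T T' u v) {x z : V} (hx : x ∈ T'.subtree z) :
    (z ≠ u → z ≠ v → x ∈ T.subtree z) ∧ (z = u ∨ z = v → x ∈ T.subtree u) := by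
  have hvu : v ∈ T.subtree u := h.isChild.mem_subtree
  obtain ⟨n, hn⟩ := hx
  induction n generalizing z with
  | zero =>
    obtain rfl : x = z := hn
    refine ⟨fun _ _ => T.mem_subtree_self x, ?_⟩
    rintro (rfl | rfl)
    · exact T.mem_subtree_self _
    · exact hvu
  | succ n ih =>
    rw [Function.iterate_succ_apply'] at hn
    generalize T'.parent^[n] x = y at hn ih
    obtain ⟨ih1, ih2⟩ := ih rfl
    by_cases hyr : y = T'.root
    · rw [hyr, T'.parent_root, ← hyr] at hn
      exact hn ▸ ⟨ih1, ih2⟩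
    by_cases hyu : y = u
    · have hzv : z = v := by rw [← hn, hyu, h.isChild'.2]
      exact ⟨fun _ h' => absurd hzv h', fun _ => ih2 (Or.inl hyu)⟩
    by_cases hyv : y = v
    · have hroot : T.root ≠ u := fun h' => hyr (hyv.trans (h.root_eq_of_eq h').symm)
      have hz : T.parent u = z := by rw [← h.parent_eq hroot, ← hyv, hn]
      have hxz : x ∈ T.subtree z := mem_subtree_trans (ih2 (Or.inr hyv)) ⟨1, hz⟩
      refine ⟨fun _ _ => hxz, fun h' => ?_⟩
      rcases h' with rfl | rfl
      · exact hxz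
      · exact mem_subtree_trans hxz hvu
    by_cases hc : T.IsChild y v
    · have hxu : x ∈ T.subtree u :=
        mem_subtree_trans (mem_subtree_trans (ih1 hyu hyv) hc.mem_subtree) hvu
      refine ⟨fun h1 h2 => ?_, fun _ => hxu⟩
      rcases h.parent_of_isChild hc with h' | h'
      · exact absurd (hn.symm.trans h') h1
      · exact absurd (hn.symm.trans h') h2
    · have hz := h.parent_of_ne y hyu hyv hc
      rw [hn] at hz
      have hxz : x ∈ T.subtree z := mem_subtree_trans (ih1 hyu hyv) ⟨1, hz.symm⟩
      refine ⟨fun _ _ => hxz, fun h' => ?_⟩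
      rcases h' with rfl | rfl
      · exact hxz
      · exact mem_subtree_trans hxz hvu

theorem subtree_eq (h : IsRotation G T T' u v) {z : V} (hu : z ≠ u) (hv : z ≠ v) :
    T'.subtree z = T.subtree z :=
  Set.ext fun _ => ⟨fun hx => (h.mem_of_mem' hx).1 hu hv, fun hx => (h.mem_of_mem hx).1 hu hv⟩

theorem subtree_eq' (h : IsRotation G T T' u v) : T'.subtree v = T.subtree u :=
  Set.ext fun _ => ⟨fun hx => (h.mem_of_mem' hx).2 (Or.inr rfl),
    fun hx => (h.mem_of_mem hx).2 (Or.inl rfl)⟩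

/-- The set `T'.subtree u` need not be prescribed: since both trees are elimination trees, adjacency
to `u` decides which subtrees of `v` pass to `u`. The criterion reduces the verification of a
rotation to comparing sets. -/
theorem of_subtree_eq (hT : T.IsEliminationTree G) (hT' : T'.IsEliminationTree G)
    (hc : T.IsChild v u) (h : ∀ z, z ≠ u → z ≠ v → T'.subtree z = T.subtree z)
    (huv : T'.subtree v = T.subtree u) : IsRotation G T T' u v := by
  have hu_mem : u ∈ T'.subtree v := huv ▸ T.mem_subtree_self u
  have hc' : T'.IsChild u v := by
    refine isChild_of_forall hu_mem hc.ne.symm fun q hq hne hqv => ?_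
    by_contra hqv'
    rw [h q hne.symm hqv'] at hq
    rw [huv] at hqv
    exact hne (mem_subtree_antisymm hq hqv)
  have habove : ∀ q, q ≠ u → q ≠ v → q ∈ T'.subtree v → v ∉ T.subtree q := by
    intro q hqu hqv hq hvq
    rw [huv] at hq
    exact hqu (mem_subtree_antisymm hq (hc.mem_subtree_of_mem hvq hqv.symm))
  /- a subtree with a neighbour of `u` ends up below `u` -/
  have hbelow : ∀ w, w ≠ u → w ≠ v → u ∉ T.subtree w → (∃ x ∈ T.subtree w, G.Adj u x) →
      v ∉ T.subtree w → w ∈ T'.subtree u := by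
    rintro w hwu hwv huw ⟨x, hx, hadj⟩ hvw
    have hxu : x ≠ u := hadj.ne.symm
    have hxv : x ≠ v := by
      rintro rfl
      exact hvw hx
    have hxu' : x ∈ T'.subtree u := by
      rcases hT'.mem_or_mem u x hadj with h' | h'
      · rw [h x hxu hxv] at h'
        exact absurd (mem_subtree_trans h' hx) huw
      · exact h'
    have hxw : x ∈ T'.subtree w := by rwa [h w hwu hwv]
    rcases mem_subtree_or_of_mem hxw hxu' with h' | h'
    · exact h'
    · rw [h w hwu hwv] at h'
      exact absurd h' huw
  refine ⟨hc, hc', fun hr => ?_, fun hr => ?_, fun hr => ?_, fun w hw hadj => ?_,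
    fun w hw hadj => ?_, fun w hwu hwv hw => ?_⟩
  · refine (eq_root_of_root_mem_subtree (T := T') ?_).symm
    rw [huv, ← hr, subtree_root]
    trivial
  · refine (eq_root_of_root_mem_subtree (T := T') ?_).symm
    rw [h _ hr hc.1.symm, subtree_root]
    trivial
  · have hp : T.IsChild u (T.parent u) := ⟨hr.symm, rfl⟩
    have hpv : T.parent u ≠ v := fun h' => by
      rw [h'] at hp
      exact hp.notMem_subtree hc.mem_subtree
    have hp' := h _ hp.ne.symm hpv
    refine parent_eq_of_forall (by
      rw [hp']
      exact mem_subtree_trans hc.mem_subtree hp.mem_subtree) hpv.symm fun q hq hne hqp => ?_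
    have hqu : q ≠ u := by
      rintro rfl
      exact hc'.notMem_subtree hq
    rw [hp'] at hqp
    rw [h q hqu hne.symm] at hq
    exact mem_subtree_antisymm hqp
      (hp.mem_subtree_of_mem (hc.mem_subtree_of_mem hq hne) hqu.symm)
  · have hvw := hw.notMem_subtree
    have hwu : w ≠ u := by
      rintro rfl
      exact hvw hc.mem_subtree
    have huw : u ∉ T.subtree w := fun h' => hvw (mem_subtree_trans hc.mem_subtree h')
    refine parent_eq_of_forall (hbelow w hwu hw.ne huw hadj hvw) hwu fun q hq hne hqu => ?_
    by_contra hqu'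
    have hqv : q ≠ v := by
      rintro rfl
      exact hc'.notMem_subtree hqu
    rw [h q hqu' hqv] at hq
    exact habove q hqu' hqv (mem_subtree_trans hqu hu_mem) (hw.mem_subtree_of_mem hq hne)
  · have hvw := hw.notMem_subtree
    have hwu : w ≠ u := by
      rintro rfl
      exact hvw hc.mem_subtree
    have hwv' : w ∈ T'.subtree v := by
      rw [huv]
      exact mem_subtree_trans hw.mem_subtree hc.mem_subtree
    have hwr := ne_root_of_mem_subtree hwv' hw.ne
    by_contra hne
    have hmem := parent_mem_subtree hwv' hw.ne
    -- The parent `u` would need a neighbour below `w`, against `hadj`; any other parent would lie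
    -- strictly between `w` and `v` in `T`, or above `v` but inside the subtree of `u`.
    by_cases hpu : T'.parent w = u
    · obtain ⟨x, hx, hx'⟩ := hT'.exists_adj w hwr
      rw [h w hwu hw.ne] at hx
      exact hadj ⟨x, hx, hpu ▸ hx'⟩
    · refine habove _ hpu hne hmem (hw.mem_subtree_of_mem ?_ (parent_ne_self hwr).symm)
      rw [← h _ hpu hne]
      exact T'.mem_subtree_parent w
  · by_cases hwr : w = T.root
    · have hwr' : w = T'.root := by
        apply eq_root_of_root_mem_subtree
        rw [h w hwu hwv, hwr, subtree_root]
        trivial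
      rw [hwr', T'.parent_root, ← hwr', hwr, T.parent_root]
    have hp : T.IsChild w (T.parent w) := ⟨hwr, rfl⟩
    have hpv : T.parent w ≠ v := fun h' => hw ⟨hwr, h'⟩
    by_cases hpu : T.parent w = u
    · rw [hpu] at hp ⊢
      have huw := hp.notMem_subtree
      have hvw : v ∉ T.subtree w := fun h' => hwv (hc.eq_of_mem_subtree hp h').symm
      obtain ⟨x, hx, hadj⟩ := hT.exists_adj w hwr
      rw [hpu] at hadj
      refine parent_eq_of_forall (hbelow w hwu hwv huw ⟨x, hx, hadj⟩ hvw) hwu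
        fun q hq hne hqu => ?_
      by_contra hqu'
      have hqv : q ≠ v := by
        rintro rfl
        exact hc'.notMem_subtree hqu
      rw [h q hqu' hqv] at hq
      have huq := hp.mem_subtree_of_mem hq hne
      have hqv' := mem_subtree_trans hqu hu_mem
      rw [huv] at hqv'
      exact hqu' (mem_subtree_antisymm hqv' huq)
    · have hp' := h _ hpu hpv
      refine parent_eq_of_forall (by rw [hp']; exact hp.mem_subtree) hp.ne fun q hq hne hqp => ?_
      rw [hp'] at hqp
      refine mem_subtree_antisymm hqp ?_
      by_cases hqu : q = u
      · subst hqu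
        refine hp.mem_subtree_of_mem ?_ hwu
        rw [← huv]
        exact mem_subtree_trans hq hu_mem
      by_cases hqv : q = v
      · subst hqv
        rw [huv] at hq
        refine absurd (mem_subtree_antisymm ?_ (hp.mem_subtree_of_mem hq hwu)).symm hpu
        exact hc.mem_subtree_of_mem hqp hpv.symm
      · rw [h q hqu hqv] at hq
        exact hp.mem_subtree_of_mem hq hne

theorem symm (h : IsRotation G T T' u v) (hT : T.IsEliminationTree G)
    (hT' : T'.IsEliminationTree G) : IsRotation G T' T v u :=
  of_subtree_eq hT' hT h.isChild' (fun _ hv hu => (h.subtree_eq hu hv).symm) h.subtree_eq'.symm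

theorem trees_ne (h : IsRotation G T T' u v) : T ≠ T' := by
  rintro rfl
  exact h.isChild.notMem_subtree h.isChild'.mem_subtree

theorem map {W : Type*} {H : SimpleGraph W} {e : V ≃ W}
    (he : ∀ x y, H.Adj (e x) (e y) ↔ G.Adj x y) (h : IsRotation G T T' u v)
    (hT : T.IsEliminationTree G) (hT' : T'.IsEliminationTree G) :
    IsRotation H (T.map e) (T'.map e) (e u) (e v) := by
  refine of_subtree_eq (hT.map e he) (hT'.map e he) (isChild_map.2 h.isChild)
    (fun z hu hv => Set.ext fun x => ?_) (Set.ext fun x => ?_)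
  · rw [mem_subtree_map, mem_subtree_map, h.subtree_eq]
    · rintro rfl
      simp at hu
    · rintro rfl
      simp at hv
  · simp [mem_subtree_map, h.subtree_eq']

end IsRotation

end LabelledRootedTree

/-! ### Universal vertices in search trees, and the new root. -/

namespace LabelledRootedTree

variable {V : Type*} {G : SimpleGraph V} {T T' : LabelledRootedTree V}

theorem IsEliminationTree.mem_or_mem_of_isUniversal (hT : T.IsEliminationTree G) {y : V}
    (hy : G.IsUniversal y) (z : V) : z ∈ T.subtree y ∨ y ∈ T.subtree z := by
  by_cases h : y = z
  · exact Or.inl (h ▸ T.mem_subtree_self y)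
  · exact (hT.mem_or_mem y z (hy h)).symm

theorem IsEliminationTree.mem_subtree_of_isChild (hT : T.IsEliminationTree G) {y u b : V}
    (hy : G.IsUniversal y) (hyu : y ∈ T.subtree u) (hne : y ≠ u) (hb : T.IsChild b u) :
    y ∈ T.subtree b := by
  rcases hT.mem_or_mem_of_isUniversal hy b with h | h
  · by_cases hby : b = y
    · exact hby ▸ T.mem_subtree_self b
    · exact absurd (mem_subtree_antisymm hyu (hb.mem_subtree_of_mem h hby)) hne
  · exact h

/-- A vertex above a universal vertex has at most one child. -/
theorem IsEliminationTree.subtree_eq_insert (hT : T.IsEliminationTree G) {y u b : V}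
    (hy : G.IsUniversal y) (hyu : y ∈ T.subtree u) (hne : y ≠ u) (hb : T.IsChild b u) :
    T.subtree u = insert u (T.subtree b) := by
  have hyb := hT.mem_subtree_of_isChild hy hyu hne hb
  ext z
  simp only [Set.mem_insert_iff]
  constructor
  · intro hz
    rcases hT.mem_or_mem_of_isUniversal hy z with h | h
    · exact Or.inr (mem_subtree_trans h hyb)
    · rcases mem_subtree_or_of_mem h hyb with h' | h'
      · exact Or.inr h'
      · by_cases hzb : b = z
        · exact Or.inr (hzb ▸ T.mem_subtree_self b)
        · exact Or.inl (mem_subtree_antisymm hz (hb.mem_subtree_of_mem h' hzb))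
  · rintro (rfl | hz)
    · exact T.mem_subtree_self _
    · exact mem_subtree_trans hz hb.mem_subtree

/-- A universal `u` is comparable with everything, so every subtree of `v` follows it and only `v`
itself leaves its subtree. -/
theorem IsRotation.subtree_eq_diff {u v : V} (h : IsRotation G T T' u v)
    (hT' : T'.IsEliminationTree G) (hu : G.IsUniversal u) :
    T'.subtree u = T.subtree u \ {v} := by
  ext z
  constructor
  · refine fun hz => ⟨(h.mem_of_mem' hz).2 (Or.inl rfl), ?_⟩
    rintro rfl
    exact h.isChild'.notMem_subtree hz
  · rintro ⟨hz, hzv⟩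
    rcases hT'.mem_or_mem_of_isUniversal hu z with h' | h'
    · exact h'
    · by_cases hzu : z = u
      · exact hzu ▸ T'.mem_subtree_self z
      · rw [h.subtree_eq hzu hzv] at h'
        exact absurd (mem_subtree_antisymm hz h') hzu

/-- The rooted tree obtained by adding `none` as a new root above the root of `T`. -/
noncomputable def addRoot (T : LabelledRootedTree V) : LabelledRootedTree (Option V) where
  root := none
  parent w := by
    classical
    exact w.elim none fun x => if x = T.root then none else some (T.parent x)
  parent_root := rfl
  exists_iterate_parent_eq_root w := by
    classical
    cases w with
    | none => exact ⟨0, rfl⟩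
    | some x =>
      obtain ⟨n, hn⟩ := T.exists_iterate_parent_eq_root x
      induction n generalizing x with
      | zero =>
        obtain rfl : x = T.root := hn
        exact ⟨1, by simp⟩
      | succ n ih =>
        by_cases hx : x = T.root
        · exact ⟨1, by simp [hx]⟩
        · obtain ⟨m, hm⟩ := ih _ (by rwa [Function.iterate_succ_apply] at hn)
          exact ⟨m + 1, by rw [Function.iterate_succ_apply]; simpa [hx] using hm⟩

theorem addRoot_parent_of_ne {x : V} (hx : x ≠ T.root) :
    T.addRoot.parent (some x) = some (T.parent x) := by
  simp [addRoot, hx]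

theorem addRoot_parent_root : T.addRoot.parent (some T.root) = none := by
  simp [addRoot]

theorem isChild_addRoot {x z : V} : T.addRoot.IsChild (some x) (some z) ↔ T.IsChild x z := by
  by_cases hx : x = T.root
  · simp [IsChild, hx, addRoot_parent_root]
  · simp only [IsChild, addRoot_parent_of_ne hx]
    simp [addRoot, hx]

theorem mem_subtree_addRoot {x z : V} :
    some x ∈ T.addRoot.subtree (some z) ↔ x ∈ T.subtree z := by
  constructor
  · rintro ⟨n, hn⟩
    induction n generalizing x with
    | zero =>
      obtain rfl : x = z := Option.some_injective _ hn
      exact T.mem_subtree_self x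
    | succ n ih =>
      rw [Function.iterate_succ_apply] at hn
      by_cases hx : x = T.root
      · rw [hx, addRoot_parent_root] at hn
        have := T.addRoot.iterate_parent_root n
        exact absurd (hn.symm.trans this) (by simp [addRoot])
      · rw [addRoot_parent_of_ne hx] at hn
        exact mem_subtree_trans (T.mem_subtree_parent x) (ih hn)
  · rintro ⟨n, hn⟩
    induction n generalizing x with
    | zero => exact hn ▸ mem_subtree_self _ _
    | succ n ih =>
      rw [Function.iterate_succ_apply] at hn
      by_cases hx : x = T.root
      · rw [hx, T.parent_root, ← hx] at hn
        exact ih hn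
      · refine mem_subtree_trans ?_ (ih hn)
        rw [← addRoot_parent_of_ne hx]
        exact mem_subtree_parent _ _

theorem none_notMem_subtree_addRoot {z : V} : none ∉ T.addRoot.subtree (some z) := fun h => by
  have := eq_root_of_root_mem_subtree (T := T.addRoot) h
  simp [addRoot] at this

/-- The only new parent relation is between `none` and the old root, and `some v` is a neighbour of
`none` below that root; universality of `v` plays no role. -/
theorem IsEliminationTree.addRoot (hT : T.IsEliminationTree G) (v : V) :
    T.addRoot.IsEliminationTree (G.addTrueTwin v) where
  mem_or_mem x y hxy := by
    have hnone : ∀ z, z ∈ T.addRoot.subtree none := fun z => by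
      have := T.addRoot.subtree_root
      exact this.symm ▸ trivial
    cases x with
    | none => exact Or.inr (hnone y)
    | some x =>
      cases y with
      | none => exact Or.inl (hnone _)
      | some y => simpa only [mem_subtree_addRoot] using hT.mem_or_mem x y hxy
  exists_adj w hw := by
    cases w with
    | none => exact absurd rfl hw
    | some x =>
      by_cases hx : x = T.root
      · refine ⟨some v, mem_subtree_addRoot.2 ?_, ?_⟩
        · rw [hx, subtree_root]
          trivial
        · rw [hx, addRoot_parent_root]
          exact Or.inl rfl
      · obtain ⟨y, hy, hadj⟩ := hT.exists_adj x hx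
        refine ⟨some y, mem_subtree_addRoot.2 hy, ?_⟩
        rw [addRoot_parent_of_ne hx]
        exact hadj

theorem IsRotation.addRoot {u w : V} (h : IsRotation G T T' u w)
    (hT : T.IsEliminationTree G) (hT' : T'.IsEliminationTree G) (v : V) :
    IsRotation (G.addTrueTwin v) T.addRoot T'.addRoot (some u) (some w) := by
  refine .of_subtree_eq (hT.addRoot v) (hT'.addRoot v) (isChild_addRoot.2 h.isChild)
    (fun z hu hw => ?_) (Set.ext fun x => ?_)
  · cases z with
    | none => exact (subtree_root T'.addRoot).trans (subtree_root T.addRoot).symm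
    | some z =>
      ext x
      cases x with
      | none => simp [none_notMem_subtree_addRoot]
      | some x =>
        rw [mem_subtree_addRoot, mem_subtree_addRoot, h.subtree_eq]
        · rintro rfl
          exact hu rfl
        · rintro rfl
          exact hw rfl
  · cases x with
    | none => simp [none_notMem_subtree_addRoot]
    | some x => rw [mem_subtree_addRoot, mem_subtree_addRoot, h.subtree_eq']

end LabelledRootedTree

/-! ### The twins are universal and interchangeable. -/

namespace SimpleGraph

variable {V : Type*} {G : SimpleGraph V} {v : V}

theorem isUniversal_none_addTrueTwin (hv : G.IsUniversal v) :
    (G.addTrueTwin v).IsUniversal none := by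
  intro w hw
  cases w with
  | none => exact absurd rfl hw
  | some x =>
    by_cases h : v = x
    · exact Or.inl h.symm
    · exact Or.inr (hv h)

theorem isUniversal_some_addTrueTwin (hv : G.IsUniversal v) :
    (G.addTrueTwin v).IsUniversal (some v) := by
  intro w hw
  cases w with
  | none => exact Or.inl rfl
  | some x => exact hv (fun h => hw (congrArg some h))

/-- Only universal vertices are moved, and an edge at a universal vertex exists as soon as its ends
differ. -/
theorem adj_swap_iff [DecidableEq V] {x y : V} (hx : G.IsUniversal x) (hy : G.IsUniversal y)
    (a b : V) : G.Adj (Equiv.swap x y a) (Equiv.swap x y b) ↔ G.Adj a b := by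
  have key : ∀ a b, G.Adj a b → G.Adj (Equiv.swap x y a) (Equiv.swap x y b) := by
    intro a b h
    have hne : Equiv.swap x y a ≠ Equiv.swap x y b := fun h' => h.ne ((Equiv.swap x y).injective h')
    by_cases ha : G.IsUniversal (Equiv.swap x y a)
    · exact ha hne
    by_cases hb : G.IsUniversal (Equiv.swap x y b)
    · exact (hb hne.symm).symm
    have hfix : ∀ c, ¬ G.IsUniversal (Equiv.swap x y c) → Equiv.swap x y c = c := by
      intro c hc
      refine Equiv.swap_apply_of_ne_of_ne ?_ ?_
      · rintro rfl
        exact hc (by rwa [Equiv.swap_apply_left])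
      · rintro rfl
        exact hc (by rwa [Equiv.swap_apply_right])
    rwa [hfix a ha, hfix b hb]
  exact ⟨fun h => by simpa using key _ _ h, key a b⟩

theorem rotationGraph_adj_of_isRotation {T T' : {T : LabelledRootedTree V // T.IsSearchTree G}}
    {u w : V} (h : LabelledRootedTree.IsRotation G T.1 T'.1 u w) : G.rotationGraph.Adj T T' :=
  ⟨fun h' => h.trees_ne (congrArg Subtype.val h'), Or.inl ⟨u, w, h⟩⟩

end SimpleGraph

/-! ### Deleting the upper twin, and the existence of a rotation. -/

namespace LabelledRootedTree

variable {V : Type*} {G : SimpleGraph V} {v : V} {T T' : LabelledRootedTree (Option V)}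

/-- Deleting the upper one of two universal twins from a search tree. -/
theorem IsEliminationTree.exists_delete_none [Finite V] (hv : G.IsUniversal v)
    (hT : T.IsEliminationTree (G.addTrueTwin v)) (hup : some v ∈ T.subtree none) :
    ∃ D : LabelledRootedTree V, D.IsEliminationTree G ∧
      ∀ z, D.subtree z = some ⁻¹' T.subtree (some z) := by
  have hvu := SimpleGraph.isUniversal_some_addTrueTwin hv
  have hvn : none ∉ T.subtree (some v) := fun h => by
    have := mem_subtree_antisymm h hup
    simp at this
  -- If `none` is the root, its only child takes over.
  have hroot : ∃ r : V, ∀ x : V, some x ∈ T.subtree (some r) := by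
    cases hr : T.root with
    | some r => exact ⟨r, fun x => by rw [← hr, subtree_root]; trivial⟩
    | none =>
      obtain ⟨b, hb, hvb⟩ := exists_isChild_mem_subtree hup (by simp)
      cases b with
      | none => exact absurd rfl hb.ne
      | some b =>
        refine ⟨b, fun x => ?_⟩
        have h1 := hT.subtree_eq_insert hvu hup (by simp) hb
        rw [← hr, subtree_root] at h1
        have h2 : some x ∈ insert T.root (T.subtree (some b)) := h1 ▸ trivial
        rw [hr] at h2
        simpa using h2
  obtain ⟨r, hr⟩ := hroot
  obtain ⟨D, hD⟩ := exists_subtree_eq (fun z : V => some ⁻¹' T.subtree (some z)) r hr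
    (fun x => T.mem_subtree_self _) (fun _ _ _ h h' => mem_subtree_trans h h')
    (fun _ _ h h' => Option.some_injective _ (mem_subtree_antisymm h h'))
    (fun _ _ _ h h' => mem_subtree_or_of_mem h h')
  have hmem : ∀ x z, x ∈ D.subtree z ↔ some x ∈ T.subtree (some z) := fun x z => by
    rw [hD]; rfl
  refine ⟨D, ⟨fun x y hxy => ?_, fun w hw => ?_⟩, hD⟩
  · rw [hmem, hmem]
    exact hT.mem_or_mem _ _ hxy
  · generalize hp : D.parent w = p
    have hwp : some w ∈ T.subtree (some p) := by
      rw [← hmem, ← hp]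
      exact D.mem_subtree_parent w
    have hne : w ≠ p := fun h => parent_ne_self hw (hp.trans h.symm)
    have hpw : p ∉ D.subtree w := hp ▸ parent_notMem_subtree hw
    have hwr := ne_root_of_mem_subtree hwp (by simpa using hne)
    -- Below `w`, the universal `v` itself is a neighbour of `p`. Otherwise `w` is not the child of
    -- `none`, as that child lies above `some v`, so deletion keeps the parent of `w`.
    by_cases hvw : some v ∈ T.subtree (some w)
    · refine ⟨v, (hmem _ _).2 hvw, (hv ?_).symm⟩
      rintro rfl
      exact hpw ((hmem _ _).2 hvw)
    · cases hq : T.parent (some w) with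
      | none =>
        exact absurd (hT.mem_subtree_of_isChild hvu hup (by simp) ⟨hwr, hq⟩) hvw
      | some q =>
        have hqp : q = p := by
          have hq' : some w ∈ T.subtree (some q) := ⟨1, hq⟩
          refine mem_subtree_antisymm (T := D) ?_ ?_
          · rw [hmem, ← hq]
            exact parent_mem_subtree hwp (by simpa using hne)
          · rw [← hp]
            refine parent_mem_subtree ((hmem _ _).2 hq') ?_
            rintro rfl
            exact parent_ne_self hwr hq
        obtain ⟨x, hx, hadj⟩ := hT.exists_adj _ hwr
        rw [hq, hqp] at hadj
        cases x with
        | none => exact absurd (mem_subtree_trans hup hx) hvw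
        | some x => exact ⟨x, (hmem _ _).2 hx, hadj⟩

/-- Take two paths that differ by exchanging the two lowest vertices, one of which is `v`. -/
theorem exists_isRotation [Finite V] [Nontrivial V] (hv : G.IsUniversal v) :
    ∃ T T' : LabelledRootedTree V, T.IsEliminationTree G ∧ T'.IsEliminationTree G ∧
      ∃ u, IsRotation G T T' u v := by
  classical
  obtain ⟨n, ⟨e⟩⟩ := Finite.exists_equiv_fin V
  have hn : 1 < n := by
    have := Finite.one_lt_card (α := V)
    rwa [Nat.card_congr e, Nat.card_fin] at this
  let g : V ≃ Fin n := e.trans (Equiv.swap (e v) ⟨0, by omega⟩)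
  have hgv : g v = ⟨0, by omega⟩ := by simp [g]
  let a : V := g.symm ⟨1, hn⟩
  have hga : g a = ⟨1, hn⟩ := by simp [a]
  have hav : a ≠ v := by
    intro h
    rw [h, hgv] at hga
    simp at hga
  have tree : ∀ g : V ≃ Fin n, ∃ T : LabelledRootedTree V, ∀ z, T.subtree z = {x | g x ≤ g z} :=
    fun g => exists_subtree_eq _ (g.symm ⟨n - 1, by omega⟩)
      (fun x => by simp [Fin.le_def]; omega) (fun x => le_refl (g x))
      (fun x y z h h' => le_trans (α := Fin n) h h')
      (fun x y h h' => g.injective (le_antisymm h h'))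
      (fun x y z _ _ => le_total (g y) (g z))
  -- With `v` in position 0 or 1, a parent other than `v` has `v` in the subtree of its child; a
  -- parent strictly between `v` and its child would push `v` to position 2 or higher.
  have helim : ∀ (g : V ≃ Fin n) (T : LabelledRootedTree V), (∀ z, T.subtree z = {x | g x ≤ g z}) →
      (g v : ℕ) ≤ 1 → T.IsEliminationTree G := by
    intro g T hT hv1
    refine ⟨fun x y _ => ?_, fun w hw => ?_⟩
    · rw [hT, hT]
      exact le_total (g x) (g y)
    · have h1 := T.mem_subtree_parent w
      rw [hT] at h1
      have h2 := parent_ne_self hw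
      generalize hp : T.parent w = p at h1 h2
      by_cases hpv : p = v
      · exact ⟨w, T.mem_subtree_self w, by rw [hpv]; exact hv (hpv ▸ h2)⟩
      · by_cases hvw : g v ≤ g w
        · exact ⟨v, by rw [hT]; exact hvw, (hv (Ne.symm hpv)).symm⟩
        · have hwv : w ≠ v := fun h => hvw (by rw [h])
          have hpv' : p ∈ T.subtree v := by
            rw [← hp]
            exact parent_mem_subtree (by rw [hT]; exact (not_le.1 hvw).le) hwv
          rw [hT] at hpv'
          have h3 : (g p : ℕ) ≠ g v := fun h => hpv (g.injective (Fin.ext h))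
          have h4 : (g p : ℕ) ≠ g w := fun h => h2 (g.injective (Fin.ext h))
          have h5 : (g w : ℕ) ≤ g p := h1
          have h6 : (g p : ℕ) ≤ g v := hpv'
          omega
  obtain ⟨T, hT⟩ := tree g
  obtain ⟨T', hT'⟩ := tree ((Equiv.swap a v).trans g)
  have hTe := helim g T hT (by simp [hgv])
  have hTe' := helim _ T' hT' (by simp [hga])
  refine ⟨T, T', hTe, hTe', a, .of_subtree_eq hTe hTe' (isChild_of_forall ?_ hav.symm
    fun q hq hne hqa => ?_) (fun z hza hzv => ?_) ?_⟩
  · rw [hT]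
    simp [hgv, hga, Fin.le_def]
  · rw [hT] at hqa
    have h1 : (g q : ℕ) ≤ g a := hqa
    have h2 : (g q : ℕ) ≠ g v := fun h => hne (g.injective (Fin.ext h)).symm
    refine g.injective (Fin.ext ?_)
    rw [hgv] at h2
    rw [hga] at h1 ⊢
    simp only at h1 h2 ⊢
    omega
  · rw [hT, hT']
    ext x
    have h1 : (g z : ℕ) ≠ g v := fun h => hzv (g.injective (Fin.ext h))
    have h2 : (g z : ℕ) ≠ g a := fun h => hza (g.injective (Fin.ext h))
    rw [hgv] at h1
    rw [hga] at h2
    simp only at h1 h2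
    simp only [Set.mem_ofPred_eq, Equiv.trans_apply, Equiv.swap_apply_of_ne_of_ne hza hzv, Fin.le_def]
    by_cases hxa : x = a
    · simp only [hxa, Equiv.swap_apply_left, hgv, hga]
      omega
    by_cases hxv : x = v
    · simp only [hxv, Equiv.swap_apply_right, hgv, hga]
      omega
    · rw [Equiv.swap_apply_of_ne_of_ne hxa hxv]
  · rw [hT, hT']
    ext x
    simp only [Set.mem_ofPred_eq, Equiv.trans_apply, Equiv.swap_apply_right, Fin.le_def]
    by_cases hxa : x = a
    · simp [hxa, hgv]
    by_cases hxv : x = v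
    · simp [hxv, hgv, hga]
    · rw [Equiv.swap_apply_of_ne_of_ne hxa hxv]

end LabelledRootedTree

/-! ### Rotations in the presence of the twins. -/

namespace LabelledRootedTree

variable {V : Type*} {G : SimpleGraph V} {v : V} {T T' : LabelledRootedTree (Option V)}

theorem none_notMem_of_some_mem {x : V} (h : some x ∈ T.subtree none) :
    none ∉ T.subtree (some x) := fun h' => by
  have := mem_subtree_antisymm h h'
  simp at this

/-- Rotating the upper one of two universal twins with its child changes the number of its
descendants by one, and becomes invisible once that twin is deleted. -/
theorem IsRotation.of_none [Finite V] (hv : G.IsUniversal v) {w : Option V}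
    (hT : T.IsEliminationTree (G.addTrueTwin v)) (hT' : T'.IsEliminationTree (G.addTrueTwin v))
    (hup : some v ∈ T.subtree none)
    (h : IsRotation (G.addTrueTwin v) T T' none w) :
    (∀ z : V, some ⁻¹' T'.subtree (some z) = some ⁻¹' T.subtree (some z)) ∧
      (T'.subtree none).ncard + 1 = (T.subtree none).ncard := by
  constructor
  · intro z
    by_cases hz : some z = w
    · rw [hz, h.subtree_eq', hT.subtree_eq_insert
        (SimpleGraph.isUniversal_some_addTrueTwin hv) hup (by simp) h.isChild]
      ext x
      simp
    · rw [h.subtree_eq (by simp) hz]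
  · rw [h.subtree_eq_diff hT' (SimpleGraph.isUniversal_none_addTrueTwin hv)]
    exact Set.ncard_sdiff_singleton_add_one h.isChild.mem_subtree (Set.toFinite _)

/-- Rotating two vertices other than the upper one of two universal twins commutes with deleting
that twin. -/
theorem IsRotation.delete_none {u w : V} {D D' : LabelledRootedTree V}
    (h : IsRotation (G.addTrueTwin v) T T' (some u) (some w))
    (hDe : D.IsEliminationTree G) (hDe' : D'.IsEliminationTree G)
    (hD : ∀ z, D.subtree z = some ⁻¹' T.subtree (some z))
    (hD' : ∀ z, D'.subtree z = some ⁻¹' T'.subtree (some z)) : IsRotation G D D' u w := by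
  refine .of_subtree_eq hDe hDe' (isChild_of_forall ?_ ?_ fun q hq hne hqu => ?_)
    (fun z hu hw => ?_) ?_
  · rw [hD]
    exact h.isChild.mem_subtree
  · exact fun h' => h.ne (congrArg some h')
  · rw [hD] at hq hqu
    exact Option.some_injective _ (mem_subtree_antisymm hqu
      (h.isChild.mem_subtree_of_mem hq (by simpa using hne)))
  · rw [hD, hD', h.subtree_eq (by simpa using hu) (by simpa using hw)]
  · rw [hD, hD', h.subtree_eq']

/-- The rotation of the two universal twins swaps them. -/
theorem IsRotation.eq_map_swap [Finite V] [DecidableEq V] (hv : G.IsUniversal v)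
    (hT : T.IsEliminationTree (G.addTrueTwin v)) (hT' : T'.IsEliminationTree (G.addTrueTwin v))
    (h : IsRotation (G.addTrueTwin v) T T' none (some v)) :
    T'.map (Equiv.swap none (some v)) = T := by
  have hup := h.isChild.mem_subtree
  have hins := hT.subtree_eq_insert (SimpleGraph.isUniversal_some_addTrueTwin hv) hup (by simp)
    h.isChild
  have hdiff := h.subtree_eq_diff hT' (SimpleGraph.isUniversal_none_addTrueTwin hv)
  have hn := none_notMem_of_some_mem hup
  -- A set containing both twins or neither is invariant under their exchange. This covers every
  -- subtree except that of the lower twin.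
  have hswap : ∀ (S : Set (Option V)), (none ∈ S ↔ some v ∈ S) →
      ∀ x, Equiv.swap none (some v) x ∈ S ↔ x ∈ S := by
    intro S hS x
    by_cases h1 : x = none
    · rw [h1, Equiv.swap_apply_left, hS]
    by_cases h2 : x = some v
    · rw [h2, Equiv.swap_apply_right, hS]
    · rw [Equiv.swap_apply_of_ne_of_ne h1 h2]
  refine eq_of_subtree_eq fun z => Set.ext fun x => ?_
  rw [mem_subtree_map, Equiv.symm_swap]
  by_cases hz1 : z = none
  · rw [hz1, Equiv.swap_apply_left, h.subtree_eq']
    exact hswap _ ⟨fun _ => hup, fun _ => T.mem_subtree_self _⟩ x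
  by_cases hz2 : z = some v
  · rw [hz2, Equiv.swap_apply_right, hdiff, hins]
    by_cases h1 : x = none
    · simp [h1, hn]
    by_cases h2 : x = some v
    · simp [h2, T.mem_subtree_self]
    · rw [Equiv.swap_apply_of_ne_of_ne h1 h2]
      simp [h1, h2]
  · rw [Equiv.swap_apply_of_ne_of_ne hz1 hz2, h.subtree_eq hz1 hz2]
    exact hswap _ ⟨fun h' => mem_subtree_trans hup h',
      fun h' => h.isChild.mem_subtree_of_mem h' (Ne.symm hz2)⟩ x

theorem IsRotation.exists_of_adj {H : SimpleGraph V} {R R' : LabelledRootedTree V}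
    (hR : R.IsEliminationTree H) (hR' : R'.IsEliminationTree H)
    (h : (∃ u w, IsRotation H R R' u w) ∨ ∃ u w, IsRotation H R' R u w) :
    ∃ u w, IsRotation H R R' u w := by
  rcases h with h | ⟨u, w, h⟩
  · exact h
  · exact ⟨w, u, h.symm hR' hR⟩

end LabelledRootedTree

/-! ### The colouring and the two inequalities. -/

namespace SimpleGraph

open LabelledRootedTree

variable {V : Type*} {G : SimpleGraph V} {v : V}

/-- A search tree on `G.addTrueTwin v` in which the new vertex is above its twin. -/
abbrev UpperTree (G : SimpleGraph V) (v : V) : Type _ :=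
  {T : LabelledRootedTree (Option V) //
    T.IsEliminationTree (G.addTrueTwin v) ∧ some v ∈ T.subtree none}

/-- `F T k` is the colour of the tree left after deleting `none`, shifted by the parity of the size
of the subtree of `none` plus `k`. The offset `k` provides a second proper colouring that differs
from the first on every tree. -/
theorem exists_upperTree_coloring [Finite V] (hv : G.IsUniversal v)
    {m : ℕ} (hc : G.rotationGraph.Colorable (m + 2)) :
    ∃ F : UpperTree G v → ℕ → Fin (m + 2), (∀ T k, F T k ≠ F T (k + 1)) ∧
      ∀ T T' : UpperTree G v, (∃ u w, IsRotation (G.addTrueTwin v) T.1 T'.1 u w) →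
        ∀ k, F T k ≠ F T' k := by
  classical
  obtain ⟨c⟩ := hc
  choose D hDe hD using fun T : UpperTree G v => T.2.1.exists_delete_none hv T.2.2
  let d (T : UpperTree G v) : Fin (m + 2) := c ⟨D T, (hDe T).isSearchTree⟩
  -- In `Fin (m + 2)` one has `0 ≠ 1`; this is where two colours are needed.
  let p (k : ℕ) : Fin (m + 2) := if Even k then 0 else 1
  have hp : ∀ k, p k ≠ p (k + 1) := by
    intro k
    by_cases hk : Even k <;> simp [p, hk, Nat.even_add_one]
  have hdnone : ∀ (T T' : UpperTree G v) (w : Option V),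
      IsRotation (G.addTrueTwin v) T.1 T'.1 none w →
      d T = d T' ∧ (T'.1.subtree none).ncard + 1 = (T.1.subtree none).ncard := by
    intro T T' w h
    obtain ⟨h1, h2⟩ := h.of_none hv T.2.1 T'.2.1 T.2.2
    have hDD : D T = D T' := eq_of_subtree_eq fun z => by rw [hD, hD, h1]
    exact ⟨by simp only [d, hDD], h2⟩
  refine ⟨fun T k => d T + p ((T.1.subtree none).ncard + k), fun T k h => ?_, ?_⟩
  · exact hp _ (add_left_cancel h)
  · rintro T T' ⟨u, w, h⟩ k heq
    simp only at heq
    cases u with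
    | none =>
      obtain ⟨h1, h2⟩ := hdnone T T' w h
      rw [h1, ← h2] at heq
      exact hp _ ((add_left_cancel heq).symm.trans (by rw [Nat.add_right_comm]))
    | some u =>
      cases w with
      | none =>
        obtain ⟨h1, h2⟩ := hdnone T' T _ (h.symm T.2.1 T'.2.1)
        rw [h1, ← h2] at heq
        exact hp _ ((add_left_cancel heq).trans (by rw [Nat.add_right_comm]))
      | some w =>
        rw [h.subtree_eq (by simp) (by simp)] at heq
        exact c.valid (rotationGraph_adj_of_isRotation
          (h.delete_none (hDe T) (hDe T') (hD T) (hD T'))) (add_right_cancel heq)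

/-- Upper trees use offset 0. The others are reflected by the automorphism exchanging the twins and
use offset 1, so rotations within either kind are settled by `hF2` and those between the kinds by
`hF1`. -/
theorem colorable_rotationGraph_addTrueTwin [Finite V] (hv : G.IsUniversal v)
    {m : ℕ} (hc : G.rotationGraph.Colorable (m + 2)) :
    (G.addTrueTwin v).rotationGraph.Colorable (m + 2) := by
  classical
  obtain ⟨F, hF1, hF2⟩ := exists_upperTree_coloring hv hc
  have hn := isUniversal_none_addTrueTwin hv
  have hs := isUniversal_some_addTrueTwin hv
  let e : Option V ≃ Option V := Equiv.swap none (some v)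
  have he : ∀ x y, (G.addTrueTwin v).Adj (e x) (e y) ↔ (G.addTrueTwin v).Adj x y :=
    adj_swap_iff hn hs
  have helim : ∀ T : {T : LabelledRootedTree (Option V) // T.IsSearchTree (G.addTrueTwin v)},
      T.1.IsEliminationTree (G.addTrueTwin v) := fun T =>
    T.2.isEliminationTree (Connected.of_isUniversal hn)
  have hex : ∀ T : {T : LabelledRootedTree (Option V) // T.IsSearchTree (G.addTrueTwin v)},
      ∃ (A : UpperTree G v) (k : ℕ), (some v ∈ T.1.subtree none ∧ A.1 = T.1 ∧ k = 0) ∨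
        (some v ∉ T.1.subtree none ∧ A.1 = T.1.map e ∧ k = 1) := by
    intro T
    by_cases h : some v ∈ T.1.subtree none
    · exact ⟨⟨T.1, helim T, h⟩, 0, Or.inl ⟨h, rfl, rfl⟩⟩
    · refine ⟨⟨T.1.map e, (helim T).map e he, ?_⟩, 1, Or.inr ⟨h, rfl, rfl⟩⟩
      rw [mem_subtree_map]
      simpa [e] using ((helim T).mem_or_mem_of_isUniversal hn (some v)).resolve_left h
  choose A k hA using hex
  have key : ∀ T T' : {T : LabelledRootedTree (Option V) // T.IsSearchTree (G.addTrueTwin v)},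
      some v ∈ T.1.subtree none → (∃ u w, IsRotation (G.addTrueTwin v) T.1 T'.1 u w) →
      F (A T) (k T) ≠ F (A T') (k T') := by
    rintro T T' hT ⟨u, w, h⟩
    rcases hA T with ⟨-, hAT, hk⟩ | ⟨h', -⟩
    swap
    · exact absurd hT h'
    rcases hA T' with ⟨-, hAT', hk'⟩ | ⟨hT', hAT', hk'⟩
    · rw [hk, hk']
      exact hF2 _ _ ⟨u, w, by rwa [hAT, hAT']⟩ 0
    -- In a rotation only the subtree of the upper vertex `u` can lose a vertex. As `some v` leaves
    -- the subtree of `none`, first `u` is `none`, and then `w`, the only vertex lost, is `some v`.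
    · have hu : u = none := by
        by_contra hu
        by_cases hw : none = w
        · subst hw
          rw [h.subtree_eq'] at hT'
          exact hT' (mem_subtree_trans hT h.isChild.mem_subtree)
        · rw [h.subtree_eq (Ne.symm hu) hw] at hT'
          exact hT' hT
      subst hu
      have hw : w = some v := by
        rw [h.subtree_eq_diff (helim T') hn] at hT'
        by_contra hw
        exact hT' ⟨hT, Ne.symm hw⟩
      subst hw
      have hAA : A T' = A T := Subtype.ext (by
        rw [hAT, hAT']
        exact h.eq_map_swap hv (helim T) (helim T'))
      rw [hk, hk', hAA]
      exact hF1 _ 0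
  refine ⟨Coloring.mk (fun T => F (A T) (k T)) ?_⟩
  rintro T T' ⟨-, h⟩
  obtain ⟨u, w, h⟩ := IsRotation.exists_of_adj (helim T) (helim T') h
  by_cases hT : some v ∈ T.1.subtree none
  · exact key T T' hT ⟨u, w, h⟩
  by_cases hT' : some v ∈ T'.1.subtree none
  · exact (key T' T hT' ⟨w, u, h.symm (helim T) (helim T')⟩).symm
  rcases hA T with ⟨h', -⟩ | ⟨-, hAT, hk⟩
  · exact absurd h' hT
  rcases hA T' with ⟨h', -⟩ | ⟨-, hAT', hk'⟩
  · exact absurd h' hT'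
  rw [hk, hk']
  refine hF2 _ _ ⟨e u, e w, ?_⟩ 1
  rw [hAT, hAT']
  exact h.map he (helim T) (helim T')

/-- Adding `v'` as a new root embeds the rotation graph of `G` into that of `G.addTrueTwin v`. -/
noncomputable def rotationGraphHomAddTrueTwin [Finite V] (hG : G.Connected) (v : V) :
    G.rotationGraph →g (G.addTrueTwin v).rotationGraph where
  toFun T := ⟨T.1.addRoot, ((T.2.isEliminationTree hG).addRoot v).isSearchTree⟩
  map_rel' := by
    rintro T T' ⟨-, h⟩
    obtain ⟨u, w, h⟩ := IsRotation.exists_of_adj (T.2.isEliminationTree hG)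
      (T'.2.isEliminationTree hG) h
    exact rotationGraph_adj_of_isRotation
      (h.addRoot (T.2.isEliminationTree hG) (T'.2.isEliminationTree hG) v)

end SimpleGraph

theorem mainTheorem6 {V : Type*} [Finite V] [Nontrivial V] (G : SimpleGraph V)
    (hG : G.Connected) (v : V) (hv : G.IsUniversal v) :
    (G.addTrueTwin v).rotationGraph.chromaticNumber = G.rotationGraph.chromaticNumber := by
  refine le_antisymm (SimpleGraph.chromaticNumber_le_of_forall_imp fun n hn => ?_)
    (SimpleGraph.chromaticNumber_mono_of_hom (SimpleGraph.rotationGraphHomAddTrueTwin hG v))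
  -- An edge of the rotation graph of `G` rules out colourings with fewer than two colours.
  obtain ⟨T, T', hT, hT', u, h⟩ := LabelledRootedTree.exists_isRotation hv
  obtain ⟨c⟩ := id hn
  have hne := c.valid (SimpleGraph.rotationGraph_adj_of_isRotation
    (T := ⟨T, hT.isSearchTree⟩) (T' := ⟨T', hT'.isSearchTree⟩) h)
  have h2 : 2 ≤ n := by
    by_contra hlt
    exact hne (Fin.ext (by omega))
  obtain ⟨m, rfl⟩ := Nat.exists_eq_add_of_le' h2
  exact SimpleGraph.colorable_rotationGraph_addTrueTwin hv hn
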